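/- Let $n\ge 1$. A Lipschitz spacetime $(\overline M^{\,n+1},\overline g)$ is a smooth (Hausdorff, second countable) manifold with a Lorentzian metric $\overline g$ whose components in every coordinate system are locally Lipschitz ($C^{0,1}$), time-oriented by a continuous timelike vector field; it is globally hyperbolic if it is strongly causal and $J^+(p)\cap J^-(q)$ is compact for all $p,q$, where causal curves are locally Lipschitz curves whose velocity is future-directed causal (in particular nonzero) almost everywhere. A smooth spacetime $(M^{n+1},g)$ is said to have $k$ asymptotically $\mathrm{AdS}_2\times S^{n-1}$ ends $\mathcal J_1,\mathcal J_2,\dots$ ($k\in\{1,2,\dots,\infty\}$) if there are a Lipschitz spacetime $(\overline M^{\,n+1},\overline g)$ and a function $\Omega\in C^{0,1}(\overline M)$ (locally Lipschitz) such that (i) $(\overline M,\overline g)$ is globally hyperbolic; (ii) $M\subset\overline M$ is open, and its topological boundary is $\partial M=\mathcal J$, where $\mathcal J=\bigsqcup_{i=1}^k\mathcal J_i$ is a disjoint union of smooth inextendible timelike curves $\mathcal J_i$ in $\overline M$; (iii) $\Omega|_M\in C^\infty(M)$, $\Omega>0$ on $M$ and $\Omega=0$ on $\mathcal J$; moreover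 every $p\in\mathcal J$ has a coordinate neighborhood $U$ in $\overline M$ such that $U\cap\mathcal J$ is connected and $d\Omega$ is bounded on $U\setminus\mathcal J$; (iv) $\overline g=\Omega^2 g$ on $M$, and the time orientation of $(M,g)$ is that of $(\overline M,\overline g)$. **Proposition.** Suppose that $(M,g)$ has $k\ge 1$ asymptotically $\mathrm{AdS}_2\times S^{n-1}$ ends, with $(\overline M,\overline g)$ and $\Omega$ as above, and let $\mathcal J_i$ be one of them. Let $0<a\le\infty$ and let $\gamma\colon(0,a)\to M$ be a future-directed, affinely parametrized $\overline g$-null geodesic with past endpoint on $\mathcal J_i$, i.e. $\gamma(\overline s)\to p\in\mathcal J_i$ in $\overline M$ as $\overline s\to 0^+$. Then $\gamma$ is past complete as a null $g$-geodesic: there is an orientation-preserving change of parameter that turns $\gamma$ into an affinely parametrized null geodesic of $g$, and for every such change of parameter the interval of values of the $g$-affine parameter is unbounded below. -/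

import Mathlib

open Set Filter Topology MeasureTheory
open scoped Manifold ContDiff



namespace Spacetime

/-- A chart of the smooth `(n+1)`-manifold `X`, i.e. a member of its maximal smooth atlas. -/
def IsChart (n : ℕ) {X : Type*} [TopologicalSpace X]
    [ChartedSpace (EuclideanSpace ℝ (Fin (n + 1))) X]
    (e : OpenPartialHomeomorph X (EuclideanSpace ℝ (Fin (n + 1)))) : Prop :=
  e ∈ IsManifold.maximalAtlas (𝓡 (n + 1)) ∞ X

/-- A field of bilinear forms on the tangent spaces of an `(n+1)`-manifold.
A metric that lives on an open set `S` only is such a field, its values off `S` being irrelevant. -/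
abbrev MetricField (n : ℕ) (X : Type*) [TopologicalSpace X]
    [ChartedSpace (EuclideanSpace ℝ (Fin (n + 1))) X] : Type _ :=
  ∀ x : X, TangentSpace (𝓡 (n + 1)) x →L[ℝ] TangentSpace (𝓡 (n + 1)) x →L[ℝ] ℝ

section Metric

variable {n : ℕ} {X : Type*} [TopologicalSpace X]
  [ChartedSpace (EuclideanSpace ℝ (Fin (n + 1))) X]

/-- The components of `g` in the chart `e`: the pullback of `g` under `e⁻¹`, a map from (the target
of `e` in) `ℝⁿ⁺¹` to bilinear forms on `ℝⁿ⁺¹`. -/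
noncomputable def components (g : MetricField n X)
    (e : OpenPartialHomeomorph X (EuclideanSpace ℝ (Fin (n + 1))))
    (y : EuclideanSpace ℝ (Fin (n + 1))) :
    EuclideanSpace ℝ (Fin (n + 1)) →L[ℝ] EuclideanSpace ℝ (Fin (n + 1)) →L[ℝ] ℝ :=
  let A : EuclideanSpace ℝ (Fin (n + 1)) →L[ℝ] EuclideanSpace ℝ (Fin (n + 1)) :=
    mfderiv (𝓡 (n + 1)) (𝓡 (n + 1)) e.symm y
  let B : EuclideanSpace ℝ (Fin (n + 1)) →L[ℝ] EuclideanSpace ℝ (Fin (n + 1)) →L[ℝ] ℝ :=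
    g (e.symm y)
  B.bilinearComp A A

/-- `g` is a Lorentzian metric, of signature `(-, +, …, +)`, at every point of `S`. -/
def IsLorentzianOn (g : MetricField n X) (S : Set X) : Prop :=
  ∀ x ∈ S, (∀ v w, g x v w = g x w v) ∧
    ∃ v, g x v v < 0 ∧ ∀ w, g x v w = 0 → w ≠ 0 → 0 < g x w w

/-- The components of `g` in every coordinate system are smooth on the open set `S`. -/
def IsSmoothOn (g : MetricField n X) (S : Set X) : Prop :=
  ∀ e, IsChart n e → ContDiffOn ℝ ∞ (components g e) (e.target ∩ e.symm ⁻¹' S)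

/-- `g` is of class `C^{0,1}`: its components in every coordinate system are locally Lipschitz. -/
def IsLipschitz (g : MetricField n X) : Prop :=
  ∀ e, IsChart n e → LocallyLipschitzOn e.target (components g e)

/-- The function `f` is of class `C^{0,1}`: locally Lipschitz in every coordinate system. -/
def IsLipschitzFunction (n : ℕ) {X : Type*} [TopologicalSpace X]
    [ChartedSpace (EuclideanSpace ℝ (Fin (n + 1))) X] (f : X → ℝ) : Prop :=
  ∀ e, IsChart n e → LocallyLipschitzOn e.target (f ∘ e.symm)

/-- The velocity vector of a curve. -/
noncomputable def velocity (n : ℕ) {X : Type*} [TopologicalSpace X]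
    [ChartedSpace (EuclideanSpace ℝ (Fin (n + 1))) X] (γ : ℝ → X) (t : ℝ) :
    TangentSpace (𝓡 (n + 1)) (γ t) :=
  mfderiv 𝓘(ℝ, ℝ) (𝓡 (n + 1)) γ t (1 : ℝ)

/-- The Christoffel symbols of the first kind, `Γ(u, v; w) = uⁱ vʲ wᵏ Γ_{k,ij}`, of `g` in the
chart `e` at the coordinate point `y`. -/
noncomputable def christoffel (g : MetricField n X)
    (e : OpenPartialHomeomorph X (EuclideanSpace ℝ (Fin (n + 1))))
    (y u v w : EuclideanSpace ℝ (Fin (n + 1))) : ℝ :=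
  (fderiv ℝ (components g e) y u v w + fderiv ℝ (components g e) y v u w
    - fderiv ℝ (components g e) y w u v) / 2

/-- `γ`, restricted to the open set `I` of parameters, is an (affinely parametrized) geodesic of
`g`: in every chart, `g_{km} (xᵐ)'' + Γ_{k,ij} (xⁱ)' (xʲ)' = 0`. To be used where `g` is smooth. -/
def IsGeodesicOn (g : MetricField n X) (γ : ℝ → X) (I : Set ℝ) : Prop :=
  ContMDiffOn 𝓘(ℝ, ℝ) (𝓡 (n + 1)) 2 γ I ∧
  ∀ e, IsChart n e → ∀ t ∈ I, γ t ∈ e.source → ∀ w,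
    components g e (e (γ t)) (deriv (deriv (e ∘ γ)) t) w
      + christoffel g e (e (γ t)) (deriv (e ∘ γ) t) (deriv (e ∘ γ) t) w = 0

end Metric

end Spacetime

open Spacetime

/-- A spacetime with metric of class `C^{0,1}` on the smooth `(n+1)`-manifold `X`: a Lorentzian
metric with locally Lipschitz components, time-oriented by a continuous timelike vector field. -/
structure LipschitzSpacetime (n : ℕ) (X : Type*) [TopologicalSpace X]
    [ChartedSpace (EuclideanSpace ℝ (Fin (n + 1))) X] [IsManifold (𝓡 (n + 1)) ∞ X] where
  metric : MetricField n X
  lorentzian : IsLorentzianOn metric univ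
  lipschitz : IsLipschitz metric
  timeField : ∀ x : X, TangentSpace (𝓡 (n + 1)) x
  continuous_timeField :
    Continuous (fun x : X => (⟨x, timeField x⟩ : TangentBundle (𝓡 (n + 1)) X))
  timelike_timeField : ∀ x, metric x (timeField x) (timeField x) < 0

namespace LipschitzSpacetime

variable {n : ℕ} {X : Type*} [TopologicalSpace X]
  [ChartedSpace (EuclideanSpace ℝ (Fin (n + 1))) X] [IsManifold (𝓡 (n + 1)) ∞ X]

/-- `v` is a future-directed causal (in particular nonzero) vector. -/
def FutureCausal (B : LipschitzSpacetime n X) {x : X} (v : TangentSpace (𝓡 (n + 1)) x) : Prop :=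
  v ≠ 0 ∧ B.metric x v v ≤ 0 ∧ B.metric x (B.timeField x) v < 0

/-- `v` is a future-directed timelike vector. -/
def FutureTimelike (B : LipschitzSpacetime n X) {x : X} (v : TangentSpace (𝓡 (n + 1)) x) : Prop :=
  B.metric x v v < 0 ∧ B.metric x (B.timeField x) v < 0

/-- `v` is a future-directed null (in particular nonzero) vector. -/
def FutureNull (B : LipschitzSpacetime n X) {x : X} (v : TangentSpace (𝓡 (n + 1)) x) : Prop :=
  v ≠ 0 ∧ B.metric x v v = 0 ∧ B.metric x (B.timeField x) v < 0

/-- `γ : [a, b] → X` is a future-directed causal curve: it is locally Lipschitz and its velocity is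
future-directed causal almost everywhere. -/
def IsCausalCurve (B : LipschitzSpacetime n X) (γ : ℝ → X) (a b : ℝ) : Prop :=
  a < b ∧ ContinuousOn γ (Icc a b) ∧
  (∀ e, IsChart n e → LocallyLipschitzOn (Icc a b ∩ γ ⁻¹' e.source) (e ∘ γ)) ∧
  ∀ᵐ t ∂(volume.restrict (Icc a b)),
    MDifferentiableAt 𝓘(ℝ, ℝ) (𝓡 (n + 1)) γ t ∧ B.FutureCausal (velocity n γ t)

/-- The causal future `J⁺(p)`. -/
def causalFuture (B : LipschitzSpacetime n X) (p : X) : Set X :=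
  {q | q = p ∨ ∃ γ a b, B.IsCausalCurve γ a b ∧ γ a = p ∧ γ b = q}

/-- The causal past `J⁻(q)`. -/
def causalPast (B : LipschitzSpacetime n X) (q : X) : Set X :=
  {p | q ∈ B.causalFuture p}

def StronglyCausal (B : LipschitzSpacetime n X) : Prop :=
  ∀ p : X, ∀ U ∈ 𝓝 p, ∃ V ∈ 𝓝 p, V ⊆ U ∧
    ∀ γ a b, B.IsCausalCurve γ a b → γ a ∈ V → γ b ∈ V → γ '' Icc a b ⊆ U

def GloballyHyperbolic (B : LipschitzSpacetime n X) : Prop :=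
  B.StronglyCausal ∧ ∀ p q, IsCompact (B.causalFuture p ∩ B.causalPast q)

/-- `c : ℝ → X` is a smooth future-directed timelike curve that is inextendible, i.e. has neither a
future nor a past endpoint. (Any smooth inextendible timelike curve has this form after a
reparametrization of its domain, which is an open interval.) -/
def IsInextendibleTimelike (B : LipschitzSpacetime n X) (c : ℝ → X) : Prop :=
  ContMDiff 𝓘(ℝ, ℝ) (𝓡 (n + 1)) ∞ c ∧ (∀ t, B.FutureTimelike (velocity n c t)) ∧
  (¬ ∃ q, Tendsto c atTop (𝓝 q)) ∧ ¬ ∃ q, Tendsto c atBot (𝓝 q)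

/-- The smooth spacetime `(M, g)`, with `M` an open subset of `X`, has the `k` asymptotically
`AdS₂ × Sⁿ⁻¹` ends `𝒥ᵢ = range (c i)`, as witnessed by the spacetime `B` on `X` (the unphysical
spacetime) and the function `Ω` (the conformal factor). The spacetime `(M, g)` is time-oriented by
the time orientation of `B`. -/
structure HasAdSEnds (B : LipschitzSpacetime n X) (M : Set X) (g : MetricField n X) (Ω : X → ℝ)
    (k : ℕ∞) (c : {i : ℕ // (i : ℕ∞) < k} → ℝ → X) : Prop where
  one_le : 1 ≤ k
  isOpen : IsOpen M
  lorentzian : IsLorentzianOn g M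
  smooth : IsSmoothOn g M
  globallyHyperbolic : B.GloballyHyperbolic
  curves : ∀ i, B.IsInextendibleTimelike (c i)
  disjoint : Pairwise fun i j => Disjoint (range (c i)) (range (c j))
  frontier_eq : frontier M = ⋃ i, range (c i)
  lipschitz_factor : IsLipschitzFunction n Ω
  smooth_factor : ContMDiffOn (𝓡 (n + 1)) 𝓘(ℝ, ℝ) ∞ Ω M
  factor_pos : ∀ x ∈ M, 0 < Ω x
  factor_zero : ∀ i, ∀ x ∈ range (c i), Ω x = 0
  /-- Every point of `𝒥` has a coordinate neighborhood `U` such that `U ∩ 𝒥` is connected and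
  `dΩ` is bounded on `U \ 𝒥`. -/
  bounded_deriv : ∀ p ∈ ⋃ i, range (c i), ∃ U ∈ 𝓝 p, IsConnected (U ∩ ⋃ i, range (c i)) ∧
    ∃ e, IsChart n e ∧ U ⊆ e.source ∧
      ∃ C : ℝ, ∀ x ∈ U \ ⋃ i, range (c i), ‖fderiv ℝ (Ω ∘ e.symm) (e x)‖ ≤ C
  conformal : ∀ x ∈ M, B.metric x = (Ω x) ^ 2 • g x

end LipschitzSpacetime

namespace Spacetime

variable {n : ℕ} {X : Type*} [TopologicalSpace X]
  [ChartedSpace (EuclideanSpace ℝ (Fin (n + 1))) X]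

/-- The orientation-preserving change of parameter `φ : J → I`, with `J` an open interval, turns
the curve `γ : I → X` into an affinely parametrized null geodesic `γ ∘ φ : J → X` of `g`. -/
def IsNullAffineReparam (g : MetricField n X) (γ : ℝ → X) (I J : Set ℝ) (φ : ℝ → ℝ) : Prop :=
  IsOpen J ∧ J.OrdConnected ∧ ContDiffOn ℝ 2 φ J ∧ StrictMonoOn φ J ∧ φ '' J = I ∧
  IsGeodesicOn g (γ ∘ φ) J ∧
  ∀ s ∈ J, velocity n (γ ∘ φ) s ≠ 0 ∧
    g ((γ ∘ φ) s) (velocity n (γ ∘ φ) s) (velocity n (γ ∘ φ) s) = 0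

/-- The curve `γ : I → X` is, up to an orientation-preserving change of parameter, a null geodesic
of `g`, and it is past complete as such: its `g`-affine parameters are unbounded below. -/
def IsPastCompleteNullGeodesic (g : MetricField n X) (γ : ℝ → X) (I : Set ℝ) : Prop :=
  (∃ J φ, IsNullAffineReparam g γ I J φ) ∧
  ∀ J φ, IsNullAffineReparam g γ I J φ → ¬ BddBelow J

end Spacetime

/-! Null geodesics are conformally invariant up to parametrization. With f = Ω ∘ γ, the curve γ ∘ φ
solves the geodesic equation of g exactly when φ'' = 2 φ'² f'(φ) / f(φ)
(`geodesic_defect_conformal`, with nondegeneracy of g for "only if"), that is, when φ' / f(φ)² is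
constant. Up to an affine change the g-affine parameter is therefore ∫ ds / f(s)², and past
completeness means that this integral diverges at 0. A bound f(s) ≤ C s suffices
(`not_bddBelow_of_reparam`).

Since Ω is locally Lipschitz and vanishes at p, that bound follows once γ approaches p at least
linearly in a chart, i.e. once the coordinate velocity v = x' stays bounded. This is the core,
`norm_sub_le_mul_of_null_geodesic`. A Lipschitz metric has bounded Christoffel symbols, but the
geodesic equation is quadratic in v, so more is needed. A linear functional τ that controls |v| on
null vectors near p reduces the equation to |τ(v)'| ≤ A τ(v)² with τ(v) > 0. Then (log τ(v))' ≥ -A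
τ(v) = -(A τ(x))', so log τ(v) + A τ(x) is nondecreasing; as x converges, τ(v) stays bounded as s →
0. -/

/-! ### Changes of parameter on the line -/

/-- A positive `C²` function `f` on an open interval `I` determines a change of parameter `φ`
with `φ' = (f ∘ φ)²`. -/
theorem exists_reparam_deriv_eq_sq {I : Set ℝ} (hI : IsOpen I) (hc : I.OrdConnected) {s₀ : ℝ}
    (hs₀ : s₀ ∈ I) {f : ℝ → ℝ} (hf : ContDiffOn ℝ 2 f I) (hpos : ∀ s ∈ I, 0 < f s) :
    ∃ (J : Set ℝ) (φ : ℝ → ℝ), IsOpen J ∧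
      J.OrdConnected ∧ ContDiffOn ℝ 2 φ J ∧ StrictMonoOn φ J ∧ φ '' J = I ∧
      ∀ t ∈ J, HasDerivAt φ (f (φ t) ^ 2) t := by
  set q : ℝ → ℝ := fun s => (f s ^ 2)⁻¹ with hq
  have hqpos : ∀ s ∈ I, 0 < q s := fun s hs => inv_pos.2 (pow_pos (hpos s hs) 2)
  have hqC : ContDiffOn ℝ 2 q I := (hf.pow 2).inv fun s hs => (pow_pos (hpos s hs) 2).ne'
  have hqc : ContinuousOn q I := hqC.continuousOn
  -- The new parameter is the antiderivative of 1/f²; φ is its inverse.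
  set T : ℝ → ℝ := fun u => ∫ s in s₀..u, q s with hT
  have hTs : ∀ s ∈ I, HasStrictDerivAt T (q s) s := fun s hs =>
    intervalIntegral.integral_hasStrictDerivAt_right
      ((hqc.mono (hc.uIcc_subset hs₀ hs)).intervalIntegrable)
      (hqc.stronglyMeasurableAtFilter hI s hs) (hqc.continuousAt (hI.mem_nhds hs))
  have hTd : ∀ s ∈ I, HasDerivAt T (q s) s := fun s hs => (hTs s hs).hasDerivAt
  have hTc : ContinuousOn T I := fun s hs => (hTd s hs).continuousAt.continuousWithinAt
  have hTC : ContDiffOn ℝ 2 T I := by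
    rw [show (2 : WithTop ℕ∞) = 1 + 1 by norm_num, contDiffOn_succ_iff_deriv_of_isOpen hI]
    refine ⟨fun s hs => (hTd s hs).differentiableAt.differentiableWithinAt, by simp, ?_⟩
    exact (hqC.of_le (by norm_num)).congr fun s hs => (hTd s hs).deriv
  have hTm : StrictMonoOn T I := by
    refine strictMonoOn_of_deriv_pos hc.convex hTc fun s hs => ?_
    rw [hI.interior_eq] at hs
    rw [(hTd s hs).deriv]
    exact hqpos s hs
  have hopen : IsOpenMap (I.domRestrict T) := by
    intro U hU
    have : I.domRestrict T '' U = T '' (Subtype.val '' U) := by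
      rw [image_image]; rfl
    rw [this, isOpen_iff_mem_nhds]
    rintro _ ⟨_, ⟨s, hs, rfl⟩, rfl⟩
    rw [← (hTs s s.2).map_nhds_eq (hqpos s s.2).ne']
    exact image_mem_map ((hI.isOpenMap_subtype_val U hU).mem_nhds (mem_image_of_mem _ hs))
  let E : OpenPartialHomeomorph ℝ ℝ := OpenPartialHomeomorph.ofContinuousOpenRestrict
    (hTm.injOn.toPartialEquiv T I) hTc hopen hI
  have htar : E.target = T '' I := rfl
  have hmem : ∀ t ∈ E.target, E.symm t ∈ I := fun t ht => E.map_target ht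
  have hd : ∀ t ∈ E.target, HasDerivAt E (q (E.symm t)) (E.symm t) := fun t ht =>
    hTd _ (hmem t ht)
  refine ⟨E.target, E.symm, E.open_target, ?_, ?_, ?_, ?_, ?_⟩
  · rw [htar]
    exact (hc.isPreconnected.image T hTc).ordConnected
  · intro t ht
    exact (E.contDiffAt_symm_deriv (hqpos _ (hmem t ht)).ne' ht (hd t ht)
      (hTC.contDiffAt (hI.mem_nhds (hmem t ht)))).contDiffWithinAt
  · intro t ht u hu htu
    rw [← hTm.lt_iff_lt (hmem t ht) (hmem u hu)]
    exact (E.right_inv ht).trans_lt (htu.trans_eq (E.right_inv hu).symm)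
  · exact E.symm.image_source_eq_target
  · intro t ht
    have := E.hasDerivAt_symm ht (hqpos _ (hmem t ht)).ne' (hd t ht)
    simpa [hq] using this

/-- If `φ'' = 2 φ'² f'(φ) / f(φ)` and `f` vanishes at least linearly at the left endpoint `0` of the
range of `φ`, then the domain of `φ` is unbounded below. -/
theorem not_bddBelow_of_reparam {I J : Set ℝ} {φ f f' : ℝ → ℝ} (hJ : IsOpen J)
    (hJc : J.OrdConnected) (hφ : ContDiffOn ℝ 2 φ J) (hmono : StrictMonoOn φ J)
    (himg : φ '' J = I) (hI : I ∈ 𝓝[>] (0 : ℝ)) (hI0 : I ⊆ Ioi 0)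
    (hf : ∀ s ∈ I, HasDerivAt f (f' s) s)
    (hpos : ∀ s ∈ I, 0 < f s)
    (hode : ∀ t ∈ J, deriv (deriv φ) t = 2 * deriv φ t ^ 2 * f' (φ t) / f (φ t))
    {C : ℝ} (hC : ∀ᶠ s in 𝓝[>] (0 : ℝ), f s ≤ C * s) : ¬ BddBelow J := by
  have hmem : ∀ t ∈ J, φ t ∈ I := fun t ht => himg ▸ mem_image_of_mem φ ht
  have hd : ∀ t ∈ J, HasDerivAt φ (deriv φ t) t := fun t ht =>
    ((hφ.contDiffAt (hJ.mem_nhds ht)).differentiableAt (by norm_num)).hasDerivAt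
  have hdd : ∀ t ∈ J, HasDerivAt (deriv φ) (deriv (deriv φ) t) t := fun t ht => by
    have h1 : ContDiffOn ℝ 1 (deriv φ) J :=
      ((contDiffOn_succ_iff_deriv_of_isOpen (n := 1) hJ).1 (by simpa [one_add_one_eq_two] using hφ)).2.2
    exact ((h1.contDiffAt (hJ.mem_nhds ht)).differentiableAt (by norm_num)).hasDerivAt
  -- A first integral of the equation for φ.
  set ψ : ℝ → ℝ := fun t => deriv φ t / f (φ t) ^ 2 with hψ
  have hψd : ∀ t ∈ J, HasDerivAt ψ 0 t := by
    intro t ht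
    have h0 := (hpos _ (hmem t ht)).ne'
    have h := (hdd t ht).div (((hf _ (hmem t ht)).comp t (hd t ht)).pow 2) (pow_ne_zero 2 h0)
    refine h.congr_deriv ?_
    simp only [Function.comp_def, hode t ht]
    field_simp
    simp only [Pi.pow_apply, Nat.cast_ofNat]
    ring
  obtain ⟨r, hr0, hr⟩ := (mem_nhdsGT_iff_exists_Ioo_subset).1 (inter_mem hI hC)
  have hr0 : 0 < r := hr0
  have hsub : ∀ s, 0 < s → s < r → ∃ t ∈ J, φ t = s ∧ f s ≤ C * s := by
    intro s h1 h2
    obtain ⟨h3, h4⟩ := hr ⟨h1, h2⟩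
    rw [← himg] at h3
    obtain ⟨t, ht, rfl⟩ := h3
    exact ⟨t, ht, rfl, h4⟩
  obtain ⟨t₀, ht₀, hφt₀, -⟩ := hsub (r / 2) (by linarith) (by linarith)
  set K := ψ t₀ with hK
  have hψK : ∀ t ∈ J, ψ t = K := fun t ht =>
    hJ.is_const_of_deriv_eq_zero hJc.isPreconnected
      (fun u hu => (hψd u hu).differentiableAt.differentiableWithinAt)
      (fun u hu => (hψd u hu).deriv) ht ht₀
  have hφK : ∀ t ∈ J, deriv φ t = K * f (φ t) ^ 2 := fun t ht => by
    rw [← hψK t ht, hψ]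
    exact (div_mul_cancel₀ _ (pow_ne_zero 2 (hpos _ (hmem t ht)).ne')).symm
  -- Strict positivity of K is not needed: K only enters an upper bound for 1/φ.
  have hKpos : 0 ≤ K := by
    have h1 : 0 ≤ deriv φ t₀ := by
      have h2 := (hd t₀ ht₀).hasDerivWithinAt (s := J)
      exact hmono.monotoneOn.derivWithin_nonneg.trans_eq
        (h2.derivWithin (hJ.uniqueDiffWithinAt ht₀))
    exact div_nonneg h1 (sq_nonneg _)
  rintro ⟨b, hb⟩
  -- (1/φ)' = -K f(φ)²/φ² ≥ -K C², so 1/φ grows at most linearly towards the past. On a domain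
  -- bounded below it would stay bounded, yet φ takes values arbitrarily close to 0.
  have hgrow : ∀ t ∈ J, t ≤ t₀ → (φ t)⁻¹ ≤ (φ t₀)⁻¹ + K * C ^ 2 * (t₀ - t) := by
    intro t ht htt
    have hsubI : Icc t t₀ ⊆ J := hJc.out ht ht₀
    have hder : ∀ u ∈ Icc t t₀, HasDerivAt (fun u => (φ u)⁻¹ + K * C ^ 2 * u)
        (-(deriv φ u) / φ u ^ 2 + K * C ^ 2) u := fun u hu => by
      have h0 : φ u ≠ 0 := (hI0 (hmem u (hsubI hu))).ne'
      exact ((hd u (hsubI hu)).inv h0).add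
        (((hasDerivAt_id u).const_mul (K * C ^ 2)).congr_deriv (mul_one _))
    have hm : MonotoneOn (fun u => (φ u)⁻¹ + K * C ^ 2 * u) (Icc t t₀) := by
      refine monotoneOn_of_deriv_nonneg (convex_Icc _ _)
        (fun u hu => (hder u hu).continuousAt.continuousWithinAt)
        (fun u hu => (hder u (interior_subset hu)).differentiableAt.differentiableWithinAt)
        fun u hu => ?_
      have hu := interior_subset hu
      have huJ := hsubI hu
      have h0 : 0 < φ u := hI0 (hmem u huJ)
      have hlt : φ u < r :=
        (hmono.monotoneOn huJ ht₀ hu.2).trans_lt (by rw [hφt₀]; linarith)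
      obtain ⟨-, -, -, hfu⟩ := hsub (φ u) h0 hlt
      have hfp := hpos _ (hmem u huJ)
      rw [(hder u hu).deriv, hφK u huJ, neg_div, neg_add_eq_sub, sub_nonneg,
        div_le_iff₀ (pow_pos h0 2)]
      have : f (φ u) ^ 2 ≤ (C * φ u) ^ 2 := pow_le_pow_left₀ hfp.le hfu 2
      nlinarith
    have := hm ⟨le_rfl, htt⟩ ⟨htt, le_rfl⟩ htt
    simp only at this
    linarith
  set D := (φ t₀)⁻¹ + K * C ^ 2 * (t₀ - b) with hD
  have hφt₀pos : 0 < φ t₀ := by rw [hφt₀]; linarith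
  have hDpos : 0 < D := by
    have h1 : 0 ≤ t₀ - b := sub_nonneg.2 (hb ht₀)
    have := inv_pos.2 hφt₀pos
    positivity
  -- D bounds 1/φ on the part of J before t₀; this value of φ violates the bound.
  set s := min (φ t₀) (D + 1)⁻¹ with hs
  have hs0 : 0 < s := lt_min hφt₀pos (by positivity)
  obtain ⟨t, ht, hts, -⟩ := hsub s hs0 ((min_le_left _ _).trans_lt (by rw [hφt₀]; linarith))
  have htt : t ≤ t₀ := by
    rw [← hmono.le_iff_le ht ht₀, hts]
    exact min_le_left _ _
  have h1 := hgrow t ht htt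
  have h2 : D + 1 ≤ (φ t)⁻¹ := by
    rw [hts, le_inv_comm₀ (by positivity) hs0]
    exact min_le_right _ _
  have h3 : K * C ^ 2 * (t₀ - t) ≤ K * C ^ 2 * (t₀ - b) :=
    mul_le_mul_of_nonneg_left (by linarith [hb ht]) (by positivity)
  linarith

/-! ### Lorentzian forms and the velocity bound for null geodesics -/

section LorentzianForm

variable {E : Type*} [NormedAddCommGroup E] [NormedSpace ℝ E] [FiniteDimensional ℝ E]

/-- A symmetric bilinear form of Lorentzian signature becomes coercive after adding the square of a
suitable linear functional. -/
theorem exists_coercive_of_lorentzian {b : E →L[ℝ] E →L[ℝ] ℝ} (hsymm : ∀ v w, b v w = b w v)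
    {T : E} (hT : b T T < 0) (hpos : ∀ w, b T w = 0 → w ≠ 0 → 0 < b w w) :
    ∃ (τ : E →L[ℝ] ℝ) (c : ℝ), 0 < c ∧ ∀ v, c * ‖v‖ ^ 2 ≤ b v v + τ v ^ 2 := by
  -- The 2 makes the added square reverse the sign in the direction of T: the new form takes the
  -- value -b(T, T) at T.
  obtain ⟨k, hk⟩ : ∃ k : ℝ, k ^ 2 = 2 / (-b T T) :=
    ⟨√(2 / (-b T T)), Real.sq_sqrt (div_nonneg zero_le_two (by linarith))⟩
  set Q : E → ℝ := fun v => b v v + ((k • b T) v) ^ 2 with hQ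
  have hQpos : ∀ v, v ≠ 0 → 0 < Q v := by
    intro v hv
    set α := b T v / b T T with hα
    have hαT : b T v = α * b T T := (div_mul_cancel₀ _ hT.ne).symm
    have horth : b T (v - α • T) = 0 := by simp [hαT]
    have hexp : b (v - α • T) (v - α • T) = b v v - α ^ 2 * b T T := by
      simp only [map_sub, map_smul, _root_.sub_apply, _root_.smul_apply,
        smul_eq_mul, hsymm v T, hαT]
      ring
    have hQv : Q v = b v v - α ^ 2 * b T T + α ^ 2 * (-b T T) := by
      have : (k * b T v) ^ 2 = 2 * α ^ 2 * (-b T T) := by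
        rw [mul_pow, hk, hαT]
        field_simp [hT.ne]
      simp only [hQ, _root_.smul_apply, smul_eq_mul, this]
      ring
    rw [hQv, ← hexp]
    by_cases h0 : v - α • T = 0
    · have hα0 : α ≠ 0 := by
        rintro h
        rw [h, zero_smul, sub_zero] at h0
        exact hv h0
      have : 0 < α ^ 2 := by positivity
      rw [h0]
      simpa using mul_pos this (neg_pos.2 hT)
    · have h1 := hpos _ horth h0
      have h2 : 0 ≤ α ^ 2 * (-b T T) := mul_nonneg (sq_nonneg _) (by linarith)
      linarith
  have hQc : Continuous Q := by fun_prop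
  refine ⟨k • b T, ?_⟩
  rcases subsingleton_or_nontrivial E with hE | hE
  · refine ⟨1, one_pos, fun v => ?_⟩
    simp [Subsingleton.elim v 0]
  obtain ⟨v₀, hv₀, hmin⟩ := (isCompact_sphere (0 : E) 1).exists_isMinOn
    (NormedSpace.sphere_nonempty.2 zero_le_one) hQc.continuousOn
  refine ⟨Q v₀, hQpos v₀ (ne_zero_of_mem_unit_sphere ⟨v₀, hv₀⟩), fun v => ?_⟩
  by_cases hv : v = 0
  · simp [hv]
  have hn : ‖v‖ ≠ 0 := norm_ne_zero_iff.2 hv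
  have hunit : ‖v‖⁻¹ • v ∈ Metric.sphere (0 : E) 1 := by
    simp [norm_smul, hn]
  have h1 : Q v₀ ≤ Q (‖v‖⁻¹ • v) := hmin hunit
  have h2 : Q (‖v‖⁻¹ • v) = (‖v‖ ^ 2)⁻¹ * Q v := by
    simp only [hQ, map_smul, _root_.smul_apply, smul_eq_mul]
    ring
  rw [h2, ← div_eq_inv_mul, le_div_iff₀ (by positivity)] at h1
  exact h1

/-- A nondegenerate bilinear form is bounded below. -/
theorem exists_lower_bound_of_lorentzian {b : E →L[ℝ] E →L[ℝ] ℝ} (hsymm : ∀ v w, b v w = b w v)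
    {T : E} (hpos : ∀ w, b T w = 0 → w ≠ 0 → 0 < b w w) :
    ∃ c : ℝ, 0 < c ∧ ∀ v, c * ‖v‖ ≤ ‖b v‖ := by
  have hker : (b : E →ₗ[ℝ] E →L[ℝ] ℝ).ker = ⊥ := by
    refine LinearMap.ker_eq_bot'.2 fun v hv => ?_
    have hv : b v = 0 := hv
    by_contra h0
    have := hpos v (by rw [hsymm, hv]; rfl) h0
    simp [hv] at this
  obtain ⟨K, hK0, hK⟩ := (b : E →ₗ[ℝ] E →L[ℝ] ℝ).exists_antilipschitzWith hker
  have hK0 : (0 : ℝ) < K := hK0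
  refine ⟨(K : ℝ)⁻¹, by positivity, fun v => ?_⟩
  have h : ‖v‖ ≤ K * ‖b v‖ := by simpa using hK.le_mul_dist v 0
  rwa [inv_mul_le_iff₀ hK0]

/-- Differentiability is not required, since `fderiv` is 0 where it fails. This bounds the
Christoffel symbols of a metric that is merely Lipschitz. -/
theorem norm_fderiv_apply_le_of_lipschitzOn {E F : Type*} [NormedAddCommGroup E] [NormedSpace ℝ E]
    [NormedAddCommGroup F] [NormedSpace ℝ F] {f : E → F} {y : E} {S : Set E} (hS : S ∈ 𝓝 y)
    {K : NNReal} (hf : LipschitzOnWith K f S) (v : E) : ‖fderiv ℝ f y v‖ ≤ K * ‖v‖ :=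
  (fderiv ℝ f y).le_of_opNorm_le (norm_fderiv_le_of_lipschitzOn ℝ hS hf) v

/-- A null geodesic of a Lipschitz Lorentzian metric that converges to a point as its affine
parameter tends to `0` does so at least linearly. The geodesic is given in coordinates. -/
theorem norm_sub_le_mul_of_null_geodesic {G : E → E →L[ℝ] E →L[ℝ] ℝ} {y₀ : E} {S : Set E} (hS : S ∈ 𝓝 y₀)
    {K : NNReal} (hG : LipschitzOnWith K G S) (hsymm : ∀ v w, G y₀ v w = G y₀ w v) {T : E}
    (hT : G y₀ T T < 0) (hpos : ∀ w, G y₀ T w = 0 → w ≠ 0 → 0 < G y₀ w w) {x : ℝ → E} {r : ℝ}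
    (hr : 0 < r) (hx : ContDiffOn ℝ 2 x (Ioo 0 r)) (hx0 : Tendsto x (𝓝[>] 0) (𝓝 y₀))
    (hne : ∀ t ∈ Ioo 0 r, deriv x t ≠ 0)
    (hnull : ∀ t ∈ Ioo 0 r, G (x t) (deriv x t) (deriv x t) = 0)
    (hgeo : ∀ t ∈ Ioo 0 r, ∀ w, G (x t) (deriv (deriv x) t) w
      + (fderiv ℝ G (x t) (deriv x t) (deriv x t) w + fderiv ℝ G (x t) (deriv x t) (deriv x t) w
        - fderiv ℝ G (x t) w (deriv x t) (deriv x t)) / 2 = 0) :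
    ∃ C : ℝ, 0 ≤ C ∧ ∀ᶠ t in 𝓝[>] (0 : ℝ), ‖x t - y₀‖ ≤ C * t := by
  obtain ⟨τ₀, c₁, hc₁, hτ₀⟩ := exists_coercive_of_lorentzian hsymm hT hpos
  obtain ⟨c₂, hc₂, hlow⟩ := exists_lower_bound_of_lorentzian hsymm hpos
  -- Moving the form by less than ε costs at most half of each constant, so both bounds at y₀
  -- persist nearby with c₁ / 2 and c₂ / 2.
  set ε := min c₁ c₂ / 2 with hε
  have hεpos : 0 < ε := half_pos (lt_min hc₁ hc₂)
  have hε₁ : ε ≤ c₁ / 2 := div_le_div_of_nonneg_right (min_le_left _ _) zero_le_two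
  have hε₂ : ε ≤ c₂ / 2 := div_le_div_of_nonneg_right (min_le_right _ _) zero_le_two
  have hnear : ∀ᶠ y in 𝓝 y₀, ‖G y - G y₀‖ < ε ∧ S ∈ 𝓝 y ∧ ‖y‖ < ‖y₀‖ + 1 := by
    have h1 : ∀ᶠ y in 𝓝 y₀, K * ‖y - y₀‖ < ε := by
      have : ContinuousAt (fun y => K * ‖y - y₀‖) y₀ := by fun_prop
      exact this.eventually_lt_const (by simpa using hεpos)
    filter_upwards [h1, hS, eventually_mem_nhds_iff.2 hS,
      continuous_norm.continuousAt.eventually_lt_const (lt_add_one ‖y₀‖)] with y h1 h2 h3 h4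
    exact ⟨(hG.norm_sub_le h2 (mem_of_mem_nhds hS)).trans_lt h1, h3, h4⟩
  obtain ⟨r₁, hr₁, hr₁s⟩ := mem_nhdsGT_iff_exists_Ioo_subset.1
    (inter_mem (hx0.eventually hnear) (Ioo_mem_nhdsGT hr))
  have hr₁ : 0 < r₁ := hr₁
  have hmem : ∀ t ∈ Ioo 0 r₁, t ∈ Ioo 0 r := fun t ht => (hr₁s ht).2
  have hd : ∀ t ∈ Ioo 0 r₁, HasDerivAt x (deriv x t) t := fun t ht =>
    ((hx.contDiffAt (isOpen_Ioo.mem_nhds (hmem t ht))).differentiableAt (by norm_num)).hasDerivAt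
  have hxd : ContDiffOn ℝ 1 (deriv x) (Ioo 0 r) :=
    ((contDiffOn_succ_iff_deriv_of_isOpen (n := 1) isOpen_Ioo).1
      (by simpa [one_add_one_eq_two] using hx)).2.2
  have hdd : ∀ t ∈ Ioo 0 r₁, HasDerivAt (deriv x) (deriv (deriv x) t) t := fun t ht =>
    ((hxd.contDiffAt (isOpen_Ioo.mem_nhds (hmem t ht))).differentiableAt (by norm_num)).hasDerivAt
  have hco : ∀ t ∈ Ioo 0 r₁, c₁ / 2 * ‖deriv x t‖ ^ 2 ≤ τ₀ (deriv x t) ^ 2 := by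
    intro t ht
    have h1 := hτ₀ (deriv x t)
    have h2 : G y₀ (deriv x t) (deriv x t) ≤ ε * ‖deriv x t‖ ^ 2 := by
      have h3 := (G y₀ - G (x t)).le_opNorm₂ (deriv x t) (deriv x t)
      rw [_root_.sub_apply, _root_.sub_apply, hnull t (hmem t ht),
        sub_zero, norm_sub_rev (G y₀), mul_assoc, ← pow_two] at h3
      exact (Real.le_norm_self _).trans (h3.trans
        (mul_le_mul_of_nonneg_right (hr₁s ht).1.1.le (sq_nonneg _)))
    nlinarith [mul_le_mul_of_nonneg_right hε₁ (sq_nonneg ‖deriv x t‖)]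
  have hτne : ∀ t ∈ Ioo 0 r₁, τ₀ (deriv x t) ≠ 0 := by
    intro t ht h0
    have h1 := hco t ht
    rw [h0] at h1
    have h2 : 0 < ‖deriv x t‖ := norm_pos_iff.2 (hne t (hmem t ht))
    have : 0 < c₁ / 2 * ‖deriv x t‖ ^ 2 := by positivity
    norm_num at h1
    linarith
  have hτc : ContinuousOn (fun t => τ₀ (deriv x t)) (Ioo 0 r₁) :=
    τ₀.continuous.comp_continuousOn (hxd.continuousOn.mono hmem)
  -- By continuity the nonvanishing τ₀(x') has one sign on the interval; replace τ₀ by -τ₀ if that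
  -- sign is negative.
  obtain ⟨τ, hτ, hτpos⟩ : ∃ τ : E →L[ℝ] ℝ, (∀ v, τ v ^ 2 = τ₀ v ^ 2) ∧
      ∀ t ∈ Ioo 0 r₁, 0 < τ (deriv x t) := by
    by_cases hsign : ∀ t ∈ Ioo 0 r₁, 0 < τ₀ (deriv x t)
    · exact ⟨τ₀, fun _ => rfl, hsign⟩
    · push Not at hsign
      obtain ⟨t₁, ht₁, hle⟩ := hsign
      refine ⟨-τ₀, fun v => by simp, fun t ht => ?_⟩
      by_contra h
      have h : 0 ≤ τ₀ (deriv x t) := by simpa using h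
      obtain ⟨t₂, ht₂, h0⟩ := isPreconnected_Ioo.intermediate_value ht₁ ht hτc ⟨hle, h⟩
      exact hτne t₂ ht₂ h0
  simp only [← hτ] at hco
  -- Three Christoffel terms, each at most K |v|² |w|, are halved to give 3/2 K; the factor (c₂ /
  -- 2)⁻¹ solves for the acceleration, and (c₁ / 2)⁻¹ trades |v|² for τ(v)².
  set A := ‖τ‖ * ((c₂ / 2)⁻¹ * (3 / 2 * K * (c₁ / 2)⁻¹)) with hA
  have hacc : ∀ t ∈ Ioo 0 r₁, |τ (deriv (deriv x) t)| ≤ A * τ (deriv x t) ^ 2 := by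
    intro t ht
    set v := deriv x t with hv
    set a := deriv (deriv x) t with ha
    have hthree : ∀ p q w, |fderiv ℝ G (x t) p q w| ≤ K * ‖p‖ * ‖q‖ * ‖w‖ := fun p q w =>
      calc |fderiv ℝ G (x t) p q w| ≤ ‖fderiv ℝ G (x t) p‖ * ‖q‖ * ‖w‖ :=
            (fderiv ℝ G (x t) p).le_opNorm₂ q w
        _ ≤ K * ‖p‖ * ‖q‖ * ‖w‖ := by
            gcongr
            exact norm_fderiv_apply_le_of_lipschitzOn (hr₁s ht).1.2.1 hG p
    have hup : ‖G (x t) a‖ ≤ 3 / 2 * K * ‖v‖ ^ 2 := by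
      refine ContinuousLinearMap.opNorm_le_bound _ (by positivity) fun w => ?_
      have h1 := hgeo t (hmem t ht) w
      have h2 := abs_le.1 (hthree v v w)
      have h3 := abs_le.1 (hthree w v v)
      rw [Real.norm_eq_abs, abs_le]
      constructor <;> nlinarith
    have hlo : c₂ / 2 * ‖a‖ ≤ ‖G (x t) a‖ := by
      have h1 := hlow a
      have h2 : ‖G y₀ a‖ ≤ ‖G (x t) a‖ + ε * ‖a‖ :=
        calc ‖G y₀ a‖ = ‖G (x t) a - (G (x t) - G y₀) a‖ := by simp
          _ ≤ ‖G (x t) a‖ + ‖(G (x t) - G y₀) a‖ := norm_sub_le _ _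
          _ ≤ ‖G (x t) a‖ + ε * ‖a‖ := by
            gcongr
            exact (G (x t) - G y₀).le_of_opNorm_le (hr₁s ht).1.1.le a
      nlinarith [mul_le_mul_of_nonneg_right hε₂ (norm_nonneg a)]
    have hvτ : ‖v‖ ^ 2 ≤ (c₁ / 2)⁻¹ * τ v ^ 2 := (le_inv_mul_iff₀ (by positivity)).2 (hco t ht)
    calc |τ a| ≤ ‖τ‖ * ‖a‖ := τ.le_opNorm a
      _ ≤ ‖τ‖ * ((c₂ / 2)⁻¹ * (3 / 2 * K * ((c₁ / 2)⁻¹ * τ v ^ 2))) := by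
          gcongr
          refine (le_inv_mul_iff₀ (by positivity)).2 (hlo.trans (hup.trans ?_))
          gcongr
      _ = A * τ v ^ 2 := by rw [hA]; ring
  have hmono : MonotoneOn (fun t => Real.log (τ (deriv x t)) + A * τ (x t)) (Ioo 0 r₁) := by
    have hder : ∀ t ∈ Ioo 0 r₁, HasDerivAt (fun t => Real.log (τ (deriv x t)) + A * τ (x t))
        (τ (deriv (deriv x) t) / τ (deriv x t) + A * τ (deriv x t)) t := fun t ht =>
      ((τ.hasFDerivAt.comp_hasDerivAt t (hdd t ht)).log (hτpos t ht).ne').add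
        ((τ.hasFDerivAt.comp_hasDerivAt t (hd t ht)).const_mul A)
    refine monotoneOn_of_deriv_nonneg (convex_Ioo _ _)
      (fun t ht => (hder t ht).continuousAt.continuousWithinAt)
      (fun t ht => (hder t (interior_subset ht)).differentiableAt.differentiableWithinAt)
      fun t ht => ?_
    have ht := interior_subset ht
    have hp := hτpos t ht
    rw [(hder t ht).deriv, ← neg_le_iff_add_nonneg, le_div_iff₀ hp]
    have := (abs_le.1 (hacc t ht)).1
    linarith
  set t₁ := r₁ / 2 with ht₁
  have ht₁m : t₁ ∈ Ioo 0 r₁ := ⟨half_pos hr₁, half_lt_self hr₁⟩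
  set D := Real.log (τ (deriv x t₁)) + A * τ (x t₁) + A * (‖τ‖ * (‖y₀‖ + 1)) with hD
  have hA0 : 0 ≤ A := by positivity
  obtain ⟨V, hV0, hV⟩ : ∃ V : ℝ, 0 ≤ V ∧ ∀ t ∈ Ioc 0 t₁, ‖deriv x t‖ ≤ V := by
    refine ⟨√((c₁ / 2)⁻¹ * Real.exp D ^ 2), Real.sqrt_nonneg _, fun t ht => ?_⟩
    have htm : t ∈ Ioo 0 r₁ := ⟨ht.1, ht.2.trans_lt ht₁m.2⟩
    have h1 := hmono htm ht₁m ht.2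
    simp only at h1
    have h2 : -(A * τ (x t)) ≤ A * (‖τ‖ * (‖y₀‖ + 1)) := by
      rw [← mul_neg]
      refine mul_le_mul_of_nonneg_left ((neg_le_abs _).trans ((τ.le_opNorm _).trans ?_)) hA0
      exact mul_le_mul_of_nonneg_left (hr₁s htm).1.2.2.le (norm_nonneg _)
    have h3 : τ (deriv x t) ≤ Real.exp D :=
      (Real.log_le_iff_le_exp (hτpos t htm)).1 (by linarith)
    refine Real.le_sqrt_of_sq_le (((le_inv_mul_iff₀ (by positivity)).2 (hco t htm)).trans ?_)
    have := (hτpos t htm).le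
    gcongr
  refine ⟨V, hV0, ?_⟩
  filter_upwards [Ioc_mem_nhdsGT ht₁m.1] with t ht
  -- Since x need not take the value y₀ at 0, the mean value inequality is applied on [s, t] and s →
  -- 0 is taken afterwards.
  have hlim : Tendsto (fun s => ‖x t - x s‖) (𝓝[>] 0) (𝓝 ‖x t - y₀‖) :=
    (tendsto_const_nhds.sub hx0).norm
  refine le_of_tendsto hlim ?_
  filter_upwards [Ioc_mem_nhdsGT ht.1] with s hs
  have h := (convex_Ioc 0 t₁).norm_image_sub_le_of_norm_deriv_le
    (fun u hu => (hd u ⟨hu.1, hu.2.trans_lt ht₁m.2⟩).differentiableAt) hV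
    (⟨hs.1, hs.2.trans ht.2⟩ : s ∈ Ioc 0 t₁) ht
  refine h.trans (mul_le_mul_of_nonneg_left ?_ hV0)
  rw [Real.norm_eq_abs, abs_of_nonneg (sub_nonneg.2 hs.2)]
  linarith [hs.1]

end LorentzianForm

/-! ### Derivative formulas for conformal factors and reparametrizations -/

section Coordinates

variable {E : Type*} [NormedAddCommGroup E] [NormedSpace ℝ E]

theorem fderiv_sq_smul_apply {F : Type*} [NormedAddCommGroup F] [NormedSpace ℝ F] {H : E → F}
    {σ : E → ℝ} {z : E} (hH : DifferentiableAt ℝ H z) (hσ : DifferentiableAt ℝ σ z) (u : E) :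
    fderiv ℝ (fun y => σ y ^ 2 • H y) z u
      = σ z ^ 2 • fderiv ℝ H z u + (2 * σ z * fderiv ℝ σ z u) • H z := by
  have h := (hσ.hasFDerivAt.pow 2).smul hH.hasFDerivAt
  rw [show (fun y => σ y ^ 2 • H y) = (fun y => σ y ^ 2) • H from rfl, h.fderiv]
  simp [mul_assoc]

theorem fderiv_conformal_apply {G H : E → E →L[ℝ] E →L[ℝ] ℝ} {σ : E → ℝ} {z : E}
    (hH : DifferentiableAt ℝ H z) (hσ : DifferentiableAt ℝ σ z)
    (hG : G =ᶠ[𝓝 z] fun y => σ y ^ 2 • H y) (u v w : E) :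
    fderiv ℝ G z u v w
      = σ z ^ 2 * fderiv ℝ H z u v w + 2 * σ z * fderiv ℝ σ z u * H z v w := by
  rw [hG.fderiv_eq]
  exact congrArg (fun b => b v w)
    (fderiv_sq_smul_apply (F := E →L[ℝ] E →L[ℝ] ℝ) hH hσ u)

theorem ContDiffAt.differentiableAt_deriv {x : ℝ → E} {t : ℝ} (hx : ContDiffAt ℝ 2 x t) :
    DifferentiableAt ℝ (deriv x) t :=
  ((hx.fderiv_right (m := 1) (by norm_num)).differentiableAt (by norm_num)).clm_apply
    (differentiableAt_const (1 : ℝ))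

theorem deriv_comp_smul {x : ℝ → E} {φ : ℝ → ℝ} {t : ℝ} (hx : ContDiffAt ℝ 2 x (φ t))
    (hφ : ContDiffAt ℝ 2 φ t) :
    deriv (x ∘ φ) t = deriv φ t • deriv x (φ t) ∧
      deriv (deriv (x ∘ φ)) t
        = deriv φ t ^ 2 • deriv (deriv x) (φ t) + deriv (deriv φ) t • deriv x (φ t) := by
  have hx1 : ∀ᶠ s in 𝓝 (φ t), DifferentiableAt ℝ x s := by
    filter_upwards [hx.eventually (by simp)] with s hs using hs.differentiableAt (by norm_num)
  have hφ1 : ∀ᶠ s in 𝓝 t, DifferentiableAt ℝ φ s := by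
    filter_upwards [hφ.eventually (by simp)] with s hs using hs.differentiableAt (by norm_num)
  have h1 : deriv (x ∘ φ) =ᶠ[𝓝 t] fun s => deriv φ s • deriv x (φ s) := by
    filter_upwards [hφ.continuousAt.eventually hx1, hφ1] with s hs hs'
    exact deriv.scomp s hs hs'
  refine ⟨h1.eq_of_nhds, ?_⟩
  rw [h1.deriv_eq]
  have h2 := hx.differentiableAt_deriv.hasDerivAt.scomp t hφ1.self_of_nhds.hasDerivAt
  have h3 := hφ.differentiableAt_deriv.hasDerivAt.smul h2
  refine h3.deriv.trans ?_
  simp [smul_smul, pow_two]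

end Coordinates

/-! ### Passing to charts, and the conformal change of the geodesic equation -/

namespace Spacetime

variable {n : ℕ} {X : Type*} [TopologicalSpace X]
  [ChartedSpace (EuclideanSpace ℝ (Fin (n + 1))) X]
  {g : MetricField n X} {e : OpenPartialHomeomorph X (EuclideanSpace ℝ (Fin (n + 1)))}
  {γ : ℝ → X} {S : Set X} {I : Set ℝ} {t : ℝ}

theorem IsChart.contMDiffOn (he : IsChart n e) :
    ContMDiffOn (𝓡 (n + 1)) (𝓡 (n + 1)) ∞ e e.source :=
  contMDiffOn_of_mem_maximalAtlas he

theorem IsChart.contMDiffOn_symm (he : IsChart n e) :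
    ContMDiffOn (𝓡 (n + 1)) (𝓡 (n + 1)) ∞ e.symm e.target :=
  contMDiffOn_symm_of_mem_maximalAtlas he

theorem velocity_comp {φ : ℝ → ℝ} (hγ : MDifferentiableAt 𝓘(ℝ, ℝ) (𝓡 (n + 1)) γ (φ t))
    (hφ : DifferentiableAt ℝ φ t) :
    velocity n (γ ∘ φ) t = deriv φ t • velocity n γ (φ t) := by
  have h := mfderiv_comp t hγ hφ.mdifferentiableAt
  refine (congrArg (fun L => L (1 : ℝ)) h).trans ?_
  rw [mfderiv_eq_fderiv]
  have h1 : fderiv ℝ φ t (1 : ℝ) = deriv φ t • (1 : ℝ) := by simp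
  exact (congrArg (mfderiv 𝓘(ℝ, ℝ) (𝓡 (n + 1)) γ (φ t)) h1).trans (map_smul _ _ _)

theorem IsChart.mdifferentiable (he : IsChart n e) : e.MDifferentiable (𝓡 (n + 1)) (𝓡 (n + 1)) :=
  ⟨he.contMDiffOn.mdifferentiableOn (by simp), he.contMDiffOn_symm.mdifferentiableOn (by simp)⟩

theorem isChart_chartAt [IsManifold (𝓡 (n + 1)) ∞ X] (x : X) :
    IsChart n (chartAt (EuclideanSpace ℝ (Fin (n + 1))) x) :=
  IsManifold.chart_mem_maximalAtlas x

theorem IsLorentzianOn.components (hg : IsLorentzianOn g S) (he : IsChart n e)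
    {y : EuclideanSpace ℝ (Fin (n + 1))} (hy : y ∈ e.target) (hyS : e.symm y ∈ S) :
    (∀ v w, components g e y v w = components g e y w v) ∧
      ∃ v, components g e y v v < 0 ∧
        ∀ w, components g e y v w = 0 → w ≠ 0 → 0 < components g e y w w := by
  have hbij := he.mdifferentiable.symm.mfderiv_bijective hy
  obtain ⟨hsymm, v, hv, hpos⟩ := hg _ hyS
  refine ⟨fun _ _ => hsymm _ _, ?_⟩
  obtain ⟨v', rfl⟩ := hbij.2 v
  refine ⟨v', hv, fun w hw hw0 => hpos _ hw ?_⟩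
  exact fun h => hw0 (hbij.1 (h.trans (map_zero _).symm))

theorem components_mfderiv (he : IsChart n e) {x : X} (hx : x ∈ e.source)
    (v w : TangentSpace (𝓡 (n + 1)) x) :
    components g e (e x) (mfderiv (𝓡 (n + 1)) (𝓡 (n + 1)) e x v)
      (mfderiv (𝓡 (n + 1)) (𝓡 (n + 1)) e x w) = g x v w := by
  have hinv : ∀ v : TangentSpace (𝓡 (n + 1)) x, mfderiv (𝓡 (n + 1)) (𝓡 (n + 1)) e.symm (e x)
      (mfderiv (𝓡 (n + 1)) (𝓡 (n + 1)) e x v) = v := fun v =>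
    congrArg (fun L => L v) (he.mdifferentiable.symm_comp_deriv hx)
  -- The tangent spaces at `e.symm (e x)` and at `x` are different types; both are read as the model
  -- space so that the base point can be rewritten.
  have hpt : ∀ z, z = x → ∀ v w : EuclideanSpace ℝ (Fin (n + 1)),
      (g z : EuclideanSpace ℝ (Fin (n + 1)) →L[ℝ] EuclideanSpace ℝ (Fin (n + 1)) →L[ℝ] ℝ) v w
        = g x v w := by
    rintro _ rfl _ _
    rfl
  have h := hpt _ (e.left_inv hx) (mfderiv (𝓡 (n + 1)) (𝓡 (n + 1)) e.symm (e x)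
      (mfderiv (𝓡 (n + 1)) (𝓡 (n + 1)) e x v)) (mfderiv (𝓡 (n + 1)) (𝓡 (n + 1)) e.symm (e x)
      (mfderiv (𝓡 (n + 1)) (𝓡 (n + 1)) e x w))
  refine Eq.trans h ?_
  exact congrArg₂ (fun v w : EuclideanSpace ℝ (Fin (n + 1)) =>
    (g x : EuclideanSpace ℝ (Fin (n + 1)) →L[ℝ] EuclideanSpace ℝ (Fin (n + 1)) →L[ℝ] ℝ) v w)
    (hinv v) (hinv w)

theorem deriv_chart_comp (he : IsChart n e) (hγ : MDifferentiableAt 𝓘(ℝ, ℝ) (𝓡 (n + 1)) γ t)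
    (ht : γ t ∈ e.source) :
    deriv (e ∘ γ) t = mfderiv (𝓡 (n + 1)) (𝓡 (n + 1)) e (γ t) (velocity n γ t) := by
  have h := mfderiv_comp t (he.mdifferentiable.mdifferentiableAt ht) hγ
  change fderiv ℝ (e ∘ γ) t 1 = _
  rw [← mfderiv_eq_fderiv]
  exact congrArg (fun L => L (1 : ℝ)) h

theorem deriv_chart_comp_ne_zero (he : IsChart n e)
    (hγ : MDifferentiableAt 𝓘(ℝ, ℝ) (𝓡 (n + 1)) γ t) (ht : γ t ∈ e.source)
    (hv : velocity n γ t ≠ 0) : deriv (e ∘ γ) t ≠ 0 := by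
  rw [deriv_chart_comp he hγ ht]
  exact fun h => hv (he.mdifferentiable.mfderiv_injective ht (h.trans (map_zero _).symm))

theorem components_deriv_chart_comp (he : IsChart n e)
    (hγ : MDifferentiableAt 𝓘(ℝ, ℝ) (𝓡 (n + 1)) γ t) (ht : γ t ∈ e.source) :
    components g e (e (γ t)) (deriv (e ∘ γ) t) (deriv (e ∘ γ) t)
      = g (γ t) (velocity n γ t) (velocity n γ t) := by
  rw [deriv_chart_comp he hγ ht]
  exact components_mfderiv he ht _ _

theorem contDiffAt_chart_comp (he : IsChart n e) (hγ : ContMDiffAt 𝓘(ℝ, ℝ) (𝓡 (n + 1)) 2 γ t)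
    (ht : γ t ∈ e.source) : ContDiffAt ℝ 2 (e ∘ γ) t := by
  rw [← contMDiffAt_iff_contDiffAt]
  exact ((he.contMDiffOn.contMDiffAt (e.open_source.mem_nhds ht)).of_le
    ENat.LEInfty.out).comp t hγ

/-- The defect in the geodesic equation of `g` of a reparametrized null geodesic of the conformal
metric `Ω² g`. -/
theorem geodesic_defect_conformal {h : MetricField n X} {Ω : X → ℝ} {M : Set X} (hM : IsOpen M)
    (hg : IsSmoothOn g M) (hΩ : ContMDiffOn (𝓡 (n + 1)) 𝓘(ℝ, ℝ) ∞ Ω M) (hpos : ∀ x ∈ M, 0 < Ω x)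
    (hconf : ∀ x ∈ M, h x = Ω x ^ 2 • g x) (he : IsChart n e) {φ : ℝ → ℝ}
    (hφ : ContDiffAt ℝ 2 φ t) (hγ : ContMDiffAt 𝓘(ℝ, ℝ) (𝓡 (n + 1)) 2 γ (φ t))
    (htM : γ (φ t) ∈ M) (hte : γ (φ t) ∈ e.source)
    (hnull : h (γ (φ t)) (velocity n γ (φ t)) (velocity n γ (φ t)) = 0)
    (hgeo : ∀ w, components h e (e (γ (φ t))) (deriv (deriv (e ∘ γ)) (φ t)) w
      + christoffel h e (e (γ (φ t))) (deriv (e ∘ γ) (φ t)) (deriv (e ∘ γ) (φ t)) w = 0)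
    (w : EuclideanSpace ℝ (Fin (n + 1))) :
    components g e (e ((γ ∘ φ) t)) (deriv (deriv (e ∘ (γ ∘ φ))) t) w
      + christoffel g e (e ((γ ∘ φ) t)) (deriv (e ∘ (γ ∘ φ)) t) (deriv (e ∘ (γ ∘ φ)) t) w
      = (deriv (deriv φ) t - 2 * deriv φ t ^ 2 * deriv (Ω ∘ γ) (φ t) / (Ω ∘ γ) (φ t))
        * components g e (e (γ (φ t))) (deriv (e ∘ γ) (φ t)) w := by
  have hγd := hγ.mdifferentiableAt (by norm_num)
  have hx := contDiffAt_chart_comp he hγ hte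
  obtain ⟨hd1, hd2⟩ := deriv_comp_smul hx hφ
  set z := e (γ (φ t)) with hz
  have hzt : z ∈ e.target := e.map_source hte
  have hzs : e.symm z = γ (φ t) := e.left_inv hte
  have hnhds : e.target ∩ e.symm ⁻¹' M ∈ 𝓝 z :=
    (e.isOpen_inter_preimage_symm hM).mem_nhds ⟨hzt, by rwa [mem_preimage, hzs]⟩
  have hH : DifferentiableAt ℝ (components g e) z :=
    ((hg e he).contDiffAt hnhds).differentiableAt (by simp)
  have hσ : DifferentiableAt ℝ (Ω ∘ e.symm) z := by
    have h1 := (hΩ.comp (he.contMDiffOn_symm.mono inter_subset_left)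
      inter_subset_right).contMDiffAt hnhds
    exact (contMDiffAt_iff_contDiffAt.1 h1).differentiableAt (by simp)
  have hcomp : ∀ y ∈ e.target ∩ e.symm ⁻¹' M,
      components h e y = (Ω ∘ e.symm) y ^ 2 • components g e y := by
    intro y hy
    ext v w
    change h (e.symm y) _ _ = Ω (e.symm y) ^ 2 * g (e.symm y) _ _
    rw [hconf _ hy.2]
    rfl
  have hG : components h e =ᶠ[𝓝 z] fun y => (Ω ∘ e.symm) y ^ 2 • components g e y :=
    eventually_of_mem hnhds hcomp
  have hσz : (Ω ∘ e.symm) z = (Ω ∘ γ) (φ t) := congrArg Ω hzs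
  have hfd : deriv (Ω ∘ γ) (φ t) = fderiv ℝ (Ω ∘ e.symm) z (deriv (e ∘ γ) (φ t)) := by
    have h1 : Ω ∘ γ =ᶠ[𝓝 (φ t)] (Ω ∘ e.symm) ∘ (e ∘ γ) := by
      filter_upwards [hγ.continuousAt.eventually (e.open_source.mem_nhds hte)] with s hs
      exact congrArg Ω (e.left_inv hs).symm
    rw [h1.deriv_eq]
    exact (hσ.hasFDerivAt.comp_hasDerivAt (φ t)
      (hx.differentiableAt (by norm_num)).hasDerivAt).deriv
  have hf0 : (Ω ∘ γ) (φ t) ≠ 0 := (hpos _ htM).ne'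
  set u := deriv (e ∘ γ) (φ t) with hu
  -- Nullity removes the term dΩ(w) g(u, u), the only part of the conformal correction not
  -- proportional to g(u, w). What remains can be absorbed by φ''.
  have hnull' : components g e z u u = 0 := by
    have h1 := components_deriv_chart_comp (g := h) he hγd hte
    rw [hnull, ← hz, hG.eq_of_nhds] at h1
    rw [hσz, _root_.smul_apply, _root_.smul_apply, smul_eq_mul] at h1
    exact (mul_eq_zero.1 h1).resolve_left (pow_ne_zero 2 hf0)
  have hw := hgeo w
  simp only [christoffel, fderiv_conformal_apply hH hσ hG, hG.eq_of_nhds, hσz, hnull',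
    _root_.smul_apply, smul_eq_mul, ← hfd] at hw
  change components g e z (deriv (deriv ((e ∘ γ) ∘ φ)) t) w
      + christoffel g e z (deriv ((e ∘ γ) ∘ φ) t) (deriv ((e ∘ γ) ∘ φ) t) w = _
  rw [hd1, hd2]
  simp only [christoffel, map_add, map_smul, _root_.add_apply, _root_.smul_apply, smul_eq_mul]
  field_simp
  field_simp at hw
  have hw := (mul_eq_zero.1 (hw.trans (mul_zero 2))).resolve_left hf0
  linear_combination deriv φ t ^ 2 * hw

end Spacetime

/-! ### Linear vanishing of Ω, and past completeness -/

/-- Along a null geodesic that starts on an end, the conformal factor vanishes at least linearly in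
the affine parameter. -/
theorem LipschitzSpacetime.HasAdSEnds.factor_le_mul {n : ℕ} {X : Type*} [TopologicalSpace X]
    [ChartedSpace (EuclideanSpace ℝ (Fin (n + 1))) X] [IsManifold (𝓡 (n + 1)) ∞ X]
    {B : LipschitzSpacetime n X} {M : Set X} {g : MetricField n X} {Ω : X → ℝ}
    {k : ℕ∞} {c : {i : ℕ // (i : ℕ∞) < k} → ℝ → X} (hends : B.HasAdSEnds M g Ω k c)
    {i : {i : ℕ // (i : ℕ∞) < k}} {I : Set ℝ} (hI : IsOpen I) (hI0 : I ∈ 𝓝[>] (0 : ℝ)) {γ : ℝ → X}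
    (hγ : IsGeodesicOn B.metric γ I) (hnull : ∀ s ∈ I, B.FutureNull (velocity n γ s))
    {p : X} (hp : p ∈ range (c i)) (hlim : Tendsto γ (𝓝[>] 0) (𝓝 p)) :
    ∃ C : ℝ, ∀ᶠ s in 𝓝[>] (0 : ℝ), (Ω ∘ γ) s ≤ C * s := by
  set e := chartAt (EuclideanSpace ℝ (Fin (n + 1))) p with he_def
  have he : IsChart n e := isChart_chartAt p
  have hpe : p ∈ e.source := mem_chart_source _ p
  have hye : e p ∈ e.target := e.map_source hpe
  have htar : 𝓝[e.target] (e p) = 𝓝 (e p) := e.open_target.nhdsWithin_eq hye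
  obtain ⟨K, S, hS, hK⟩ := B.lipschitz e he hye
  obtain ⟨L, S', hS', hL⟩ := hends.lipschitz_factor e he hye
  rw [htar] at hS hS'
  obtain ⟨hsymm, T, hT, hpos⟩ :=
    IsLorentzianOn.components B.lorentzian he hye (mem_univ (e.symm (e p)))
  obtain ⟨r, hr, hrs⟩ := mem_nhdsGT_iff_exists_Ioo_subset.1
    (inter_mem hI0 (hlim.eventually (e.open_source.mem_nhds hpe)))
  have hγd : ∀ t ∈ Ioo 0 r, ContMDiffAt 𝓘(ℝ, ℝ) (𝓡 (n + 1)) 2 γ t := fun t ht =>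
    hγ.1.contMDiffAt (hI.mem_nhds (hrs ht).1)
  have hγm : ∀ t ∈ Ioo 0 r, MDifferentiableAt 𝓘(ℝ, ℝ) (𝓡 (n + 1)) γ t := fun t ht =>
    (hγd t ht).mdifferentiableAt (by norm_num)
  have hx0 : Tendsto (e ∘ γ) (𝓝[>] 0) (𝓝 (e p)) := (e.continuousAt hpe).tendsto.comp hlim
  obtain ⟨V, hV0, hV⟩ := norm_sub_le_mul_of_null_geodesic hS hK hsymm hT hpos hr
    (x := e ∘ γ)
    (fun t ht => (contDiffAt_chart_comp he (hγd t ht) (hrs ht).2).contDiffWithinAt) hx0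
    (fun t ht => deriv_chart_comp_ne_zero he (hγm t ht) (hrs ht).2 (hnull t (hrs ht).1).1)
    (fun t ht => (components_deriv_chart_comp he (hγm t ht) (hrs ht).2).trans
      (hnull t (hrs ht).1).2.1)
    (fun t ht w => hγ.2 e he t (hrs ht).1 (hrs ht).2 w)
  refine ⟨L * V, ?_⟩
  filter_upwards [hV, hx0.eventually hS', hlim.eventually (e.open_source.mem_nhds hpe)]
    with s hs hsS hse
  have h1 := hL.norm_sub_le hsS (mem_of_mem_nhds hS')
  have h2 : Ω (e.symm (e (γ s))) = Ω (γ s) := congrArg Ω (e.left_inv hse)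
  have h3 : Ω (e.symm (e p)) = 0 := (congrArg Ω (e.left_inv hpe)).trans
    (hends.factor_zero i p hp)
  simp only [Function.comp_apply, h2, h3, sub_zero] at h1
  rw [mul_assoc]
  exact (Real.le_norm_self _).trans (h1.trans (mul_le_mul_of_nonneg_left hs L.2))

theorem mainTheorem8 {n : ℕ} {X : Type*} [TopologicalSpace X] [T2Space X]
    [SecondCountableTopology X] [ChartedSpace (EuclideanSpace ℝ (Fin (n + 1))) X]
    [IsManifold (𝓡 (n + 1)) ∞ X]
    (B : LipschitzSpacetime n X) (M : Set X) (g : MetricField n X) (Ω : X → ℝ)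
    (k : ℕ∞) (c : {i : ℕ // (i : ℕ∞) < k} → ℝ → X)
    (hends : B.HasAdSEnds M g Ω k c)
    (i : {i : ℕ // (i : ℕ∞) < k})
    (a : EReal) (ha : 0 < a) (γ : ℝ → X)
    (hγM : ∀ s : ℝ, 0 < s → (s : EReal) < a → γ s ∈ M)
    (hγ : IsGeodesicOn B.metric γ {s : ℝ | 0 < s ∧ (s : EReal) < a})
    (hnull : ∀ s : ℝ, 0 < s → (s : EReal) < a → B.FutureNull (velocity n γ s))
    (p : X) (hp : p ∈ range (c i)) (hlim : Tendsto γ (𝓝[>] 0) (𝓝 p)) :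
    IsPastCompleteNullGeodesic g γ {s : ℝ | 0 < s ∧ (s : EReal) < a} := by
  set I : Set ℝ := {s : ℝ | 0 < s ∧ (s : EReal) < a} with hIdef
  have hI : IsOpen I := (isOpen_lt continuous_const continuous_id).inter
    (isOpen_lt continuous_coe_real_ereal continuous_const)
  have hIc : I.OrdConnected := ⟨fun s hs t ht u hu =>
    ⟨hs.1.trans_le hu.1, (EReal.coe_le_coe_iff.2 hu.2).trans_lt ht.2⟩⟩
  obtain ⟨s₀, hs₀, hs₀a⟩ := EReal.lt_iff_exists_real_btwn.1 ha
  have hs₀0 : 0 < s₀ := by exact_mod_cast hs₀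
  have hI0 : I ∈ 𝓝[>] (0 : ℝ) := by
    filter_upwards [Ioc_mem_nhdsGT hs₀0] with s hs
    exact ⟨hs.1, (EReal.coe_le_coe_iff.2 hs.2).trans_lt hs₀a⟩
  have hmemM : ∀ s ∈ I, γ s ∈ M := fun s hs => hγM s hs.1 hs.2
  have hmemN : ∀ s ∈ I, B.FutureNull (velocity n γ s) := fun s hs => hnull s hs.1 hs.2
  have hfpos : ∀ s ∈ I, 0 < (Ω ∘ γ) s := fun s hs => hends.factor_pos _ (hmemM s hs)
  have hfC : ContDiffOn ℝ 2 (Ω ∘ γ) I := contMDiffOn_iff_contDiffOn.1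
    ((hends.smooth_factor.of_le ENat.LEInfty.out).comp hγ.1 hmemM)
  have hfd : ∀ s ∈ I, HasDerivAt (Ω ∘ γ) (deriv (Ω ∘ γ) s) s := fun s hs =>
    ((hfC.contDiffAt (hI.mem_nhds hs)).differentiableAt (by norm_num)).hasDerivAt
  have hγd : ∀ s ∈ I, ContMDiffAt 𝓘(ℝ, ℝ) (𝓡 (n + 1)) 2 γ s := fun s hs =>
    hγ.1.contMDiffAt (hI.mem_nhds hs)
  have hγm : ∀ s ∈ I, MDifferentiableAt 𝓘(ℝ, ℝ) (𝓡 (n + 1)) γ s := fun s hs =>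
    (hγd s hs).mdifferentiableAt (by norm_num)
  have hdefect : ∀ (φ : ℝ → ℝ) (t : ℝ), ContDiffAt ℝ 2 φ t → φ t ∈ I → ∀ e, IsChart n e →
      γ (φ t) ∈ e.source → ∀ w, _ := fun φ t hφ ht e he hte =>
    geodesic_defect_conformal hends.isOpen hends.smooth hends.smooth_factor hends.factor_pos
      hends.conformal he hφ (hγd _ ht) (hmemM _ ht) hte (hmemN _ ht).2.1 (hγ.2 e he _ ht hte)
  constructor
  -- The choice φ' = f(φ)² normalizes the first integral to 1 and makes the defect vanish.
  · obtain ⟨J, φ, hJ, hJc, hφ, hmono, himg, hφ'⟩ := exists_reparam_deriv_eq_sq hI hIc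
      (⟨hs₀0, hs₀a⟩ : s₀ ∈ I) hfC hfpos
    have hmem : ∀ t ∈ J, φ t ∈ I := fun t ht => himg ▸ mem_image_of_mem φ ht
    have hvel : ∀ t ∈ J, velocity n (γ ∘ φ) t = deriv φ t • velocity n γ (φ t) := fun t ht =>
      velocity_comp (hγm _ (hmem t ht)) (hφ' t ht).differentiableAt
    have hder : ∀ t ∈ J, deriv φ t = (Ω ∘ γ) (φ t) ^ 2 := fun t ht => (hφ' t ht).deriv
    refine ⟨J, φ, hJ, hJc, hφ, hmono, himg, ⟨hγ.1.comp hφ.contMDiffOn hmem, ?_⟩, ?_⟩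
    · intro e he t ht hte w
      have h2 : deriv (deriv φ) t
          = 2 * (Ω ∘ γ) (φ t) * (deriv (Ω ∘ γ) (φ t) * deriv φ t) := by
        have h3 : deriv φ =ᶠ[𝓝 t] fun u => ((Ω ∘ γ) ∘ φ) u ^ 2 :=
          eventually_of_mem (hJ.mem_nhds ht) hder
        rw [h3.deriv_eq]
        have h4 := ((hfd _ (hmem t ht)).comp t (hφ' t ht)).pow 2
        refine h4.deriv.trans ?_
        rw [hder t ht]
        simp
      rw [hdefect φ t (hφ.contDiffAt (hJ.mem_nhds ht)) (hmem t ht) e he hte, h2, hder t ht]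
      have h0 := (hfpos _ (hmem t ht)).ne'
      field_simp
      ring
    · intro t ht
      have hne : deriv φ t ≠ 0 := by
        rw [hder t ht]
        exact pow_ne_zero 2 (hfpos _ (hmem t ht)).ne'
      obtain ⟨hv0, hvn, -⟩ := hmemN _ (hmem t ht)
      have hgn : g (γ (φ t)) (velocity n γ (φ t)) (velocity n γ (φ t)) = 0 := by
        rw [hends.conformal _ (hmemM _ (hmem t ht))] at hvn
        exact (mul_eq_zero.1 hvn).resolve_left (pow_ne_zero 2 (hfpos _ (hmem t ht)).ne')
      rw [hvel t ht]
      refine ⟨smul_ne_zero hne hv0, ?_⟩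
      change g (γ (φ t)) (deriv φ t • velocity n γ (φ t)) (deriv φ t • velocity n γ (φ t)) = 0
      rw [map_smul, map_smul, _root_.smul_apply, hgn, smul_zero, smul_zero]
  · rintro J φ ⟨hJ, hJc, hφ, hmono, himg, hgeo, -⟩
    obtain ⟨C, hC⟩ := hends.factor_le_mul hI hI0 hγ hmemN hp hlim
    refine not_bddBelow_of_reparam hJ hJc hφ hmono himg hI0 (fun s hs => hs.1) hfd hfpos
      (fun t ht => ?_) hC
    have htI : φ t ∈ I := himg ▸ mem_image_of_mem φ ht
    set e := chartAt (EuclideanSpace ℝ (Fin (n + 1))) (γ (φ t))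
    have he : IsChart n e := isChart_chartAt _
    have hte : γ (φ t) ∈ e.source := mem_chart_source _ _
    obtain ⟨hsymm, T, -, hpos⟩ := IsLorentzianOn.components hends.lorentzian he
      (e.map_source hte) (by rw [e.left_inv hte]; exact hmemM _ htI)
    obtain ⟨b, hb0, hb⟩ := exists_lower_bound_of_lorentzian hsymm hpos
    have hu := deriv_chart_comp_ne_zero he (hγm _ htI) hte (hmemN _ htI).1
    have hne : components g e (e (γ (φ t))) (deriv (e ∘ γ) (φ t)) ≠ 0 := by
      intro h0
      have h1 := hb (deriv (e ∘ γ) (φ t))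
      rw [h0, norm_zero] at h1
      exact absurd h1 (not_le.2 (mul_pos hb0 (norm_pos_iff.2 hu)))
    -- The velocity is null and cannot test itself; nondegeneracy supplies another vector w, and the
    -- vanishing defect paired with w forces the equation for φ.
    obtain ⟨w, hw⟩ : ∃ w, components g e (e (γ (φ t))) (deriv (e ∘ γ) (φ t)) w ≠ 0 := by
      by_contra! h
      exact hne (ContinuousLinearMap.ext h)
    have h1 := hdefect φ t (hφ.contDiffAt (hJ.mem_nhds ht)) htI e he hte w
    rw [hgeo.2 e he t ht hte w] at h1
    exact sub_eq_zero.1 ((mul_eq_zero.1 h1.symm).resolve_right hw)
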